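/- Let $N\ge 1$ be an integer and $s\in(0,1)$ with $N>2s$; put $2^*_s=\frac{2N}{N-2s}$. Let $$D^{s,2}(\mathbb{R}^N)=\Big\{u\in L^{2^*_s}(\mathbb{R}^N):\ \|u\|_{D^{s,2}(\mathbb{R}^N)}^2:=\int_{\mathbb{R}^N}\int_{\mathbb{R}^N}\frac{(u(x)-u(y))^2}{|x-y|^{N+2s}}\,dx\,dy<\infty\Big\}$$ (real-valued functions). Let $R>0$ and let $B_R$ be the open ball of radius $R$ centred at the origin of $\mathbb{R}^N$. Suppose that $u\in D^{s,2}(\mathbb{R}^N)$ satisfies $u=0$ a.e. in $B_R$. Then there exists a sequence $(\phi_n)\subset C_c^\infty(\mathbb{R}^N\setminus\overline{B}_R)$ (smooth functions with compact support contained in $\mathbb{R}^N\setminus\overline{B}_R$), with $\phi_n\in D^{s,2}(\mathbb{R}^N)$ for every $n$, such that $\|\phi_n-u\|_{D^{s,2}(\mathbb{R}^N)}\to 0$ as $n\to\infty$. Moreover, if $u\ge 0$ a.e. in $\mathbb{R}^N$, the sequence can be chosen so that in addition $\phi_n\ge 0$ for every $n$. -/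

import Mathlib

open MeasureTheory Metric Filter Topology
open scoped ENNReal

/-- The fractional critical Sobolev exponent `2N / (N - 2s)`; it is used only for `2s < N`. -/
noncomputable def fracCritExp (N : ℕ) (s : ℝ) : ℝ≥0∞ :=
  ENNReal.ofReal (2 * (N : ℝ) / ((N : ℝ) - 2 * s))

/-- The squared Gagliardo seminorm `∫∫ (u x - u y)² / |x - y|^(N + 2s) dx dy`, as an extended
nonnegative number (so that divergence is recorded as `∞`). The integrand on the diagonal
is `0 / 0 = 0`. -/
noncomputable def gagliardoEnergy {N : ℕ} (s : ℝ) (u : EuclideanSpace ℝ (Fin N) → ℝ) : ℝ≥0∞ :=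
  ∫⁻ y, ∫⁻ x, ENNReal.ofReal ((u x - u y) ^ 2 / ‖x - y‖ ^ ((N : ℝ) + 2 * s))

/-- The norm of the homogeneous fractional Sobolev space, the square root of
`gagliardoEnergy`. -/
noncomputable def fracNorm {N : ℕ} (s : ℝ) (u : EuclideanSpace ℝ (Fin N) → ℝ) : ℝ≥0∞ :=
  gagliardoEnergy s u ^ (1 / 2 : ℝ)

/-- Membership in the homogeneous fractional Sobolev space: `u` lies in `L^{2N/(N-2s)}`
and its Gagliardo energy is finite. -/
def MemFracSobolev {N : ℕ} (s : ℝ) (u : EuclideanSpace ℝ (Fin N) → ℝ) : Prop :=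
  MemLp u (fracCritExp N s) volume ∧ gagliardoEnergy s u < ∞

/-- The open complement of the closed ball of radius `R` centred at the origin. -/
def ballExterior (N : ℕ) (R : ℝ) : TopologicalSpace.Opens (EuclideanSpace ℝ (Fin N)) :=
  ⟨(closedBall 0 R)ᶜ, isClosed_closedBall.isOpen_compl⟩

/-!
The Gagliardo seminorm of `u` is the `L²` norm on pairs of points of the difference quotient
`D u (x, y) = (u x - u y) / |x - y| ^ ((N + 2 s) / 2)`. Four operations that converge for this
seminorm and preserve nonnegativity turn `u` into a test function. Truncating the small and the
large values makes `u` bounded with support of finite measure, hence square integrable; a dilation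
`u (c x)` with `c < 1` opens a gap between the support and the closed ball; a cutoff at infinity
makes the support compact; a mollification makes the function smooth.

Truncation and cutoff converge by dominated convergence: `|D (T ∘ u)| ≤ K |D u|` when `T` is
`K`-Lipschitz, and `|D η| ≤ min 1 |x - y| / |x - y| ^ ((N + 2 s) / 2)` for a cutoff `η`, where the
right-hand side is square integrable in `x - y` because `0 < s < 1`. For the dilation and the
mollification, `D` intertwines dilations and diagonal translations of pairs with those of points, so
both reduce to the continuity of affine changes of variables in `L²`, applied to `D u`.
-/

section Lp

variable {X Y F ι : Type*} [MeasurableSpace X] [NormedAddCommGroup F] {μ : Measure X} {p : ℝ≥0∞}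
  {l : Filter ι} [l.IsCountablyGenerated]

theorem tendsto_eLpNorm_zero_of_dominated {f : ι → X → F} {g : X → ℝ} (hp : p ≠ ∞)
    (hf : ∀ᶠ i in l, AEStronglyMeasurable (f i) μ) (hg : MemLp g p μ)
    (hfg : ∀ᶠ i in l, ∀ᵐ x ∂μ, ‖f i x‖ ≤ g x)
    (hlim : ∀ᵐ x ∂μ, Tendsto (fun i => f i x) l (𝓝 0)) :
    Tendsto (fun i => eLpNorm (f i) p μ) l (𝓝 0) := by
  rcases eq_or_ne p 0 with rfl | hp0
  · simpa only [eLpNorm_exponent_zero] using tendsto_const_nhds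
  lift p to NNReal using hp
  have hp0 : p ≠ 0 := by exact_mod_cast hp0
  have hpow : Tendsto (fun i => ∫⁻ x, ‖f i x‖ₑ ^ (p : ℝ) ∂μ) l (𝓝 (∫⁻ _, 0 ∂μ)) := by
    refine tendsto_lintegral_filter_of_dominated_convergence' (fun x => ‖g x‖ₑ ^ (p : ℝ)) ?_ ?_
      ?_ ?_
    · filter_upwards [hf] with i hi using hi.enorm.pow_const _
    · filter_upwards [hfg] with i hi
      filter_upwards [hi] with x hx
      gcongr
      exact enorm_le_iff_norm_le.2 (hx.trans (Real.le_norm_self _))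
    · rw [← eLpNorm_nnreal_pow_eq_lintegral hp0]
      exact ENNReal.rpow_ne_top_of_nonneg p.2 hg.eLpNorm_ne_top
    · filter_upwards [hlim] with x hx
      have := (ENNReal.continuous_rpow_const (y := (p : ℝ))).tendsto _ |>.comp hx.enorm
      simpa [Function.comp_def, pos_iff_ne_zero, hp0] using this
  have hroot := (ENNReal.continuous_rpow_const (y := (p : ℝ)⁻¹)).tendsto _ |>.comp hpow
  simp only [← eLpNorm_nnreal_pow_eq_lintegral hp0] at hroot
  simpa [Function.comp_def, pos_iff_ne_zero, hp0] using hroot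

theorem eLpNorm_integral_le_of_ae_le [NormedSpace ℝ F] [MeasurableSpace Y] {ν : Measure Y}
    [SFinite μ] [IsProbabilityMeasure ν] {G : X → Y → F} (hp1 : 1 ≤ p) (hp : p ≠ ∞)
    (hG : AEStronglyMeasurable (Function.uncurry G) (μ.prod ν)) {C : ℝ≥0∞}
    (hC : ∀ᵐ y ∂ν, eLpNorm (fun x => G x y) p μ ≤ C) :
    eLpNorm (fun x => ∫ y, G x y ∂ν) p μ ≤ C := by
  lift p to NNReal using hp
  have hp0 : 0 < p := by exact_mod_cast one_pos.trans_le hp1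
  rw [← ENNReal.rpow_le_rpow_iff (z := (p : ℝ)) (by exact_mod_cast hp0),
    eLpNorm_nnreal_pow_eq_lintegral hp0.ne']
  calc ∫⁻ x, ‖∫ y, G x y ∂ν‖ₑ ^ (p : ℝ) ∂μ
      ≤ ∫⁻ x, ∫⁻ y, ‖G x y‖ₑ ^ (p : ℝ) ∂ν ∂μ := by
        refine lintegral_mono_ae ?_
        filter_upwards [hG.prodMk_left] with x hx
        rw [← eLpNorm_nnreal_pow_eq_lintegral hp0.ne']
        gcongr
        calc ‖∫ y, G x y ∂ν‖ₑ ≤ eLpNorm (G x) 1 ν := by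
              rw [eLpNorm_one_eq_lintegral_enorm]
              exact enorm_integral_le_lintegral_enorm _
          _ ≤ eLpNorm (G x) p ν := eLpNorm_le_eLpNorm_of_exponent_le hp1 hx
    _ = ∫⁻ y, ∫⁻ x, ‖G x y‖ₑ ^ (p : ℝ) ∂μ ∂ν :=
        lintegral_lintegral_swap (hG.enorm.pow_const _)
    _ ≤ ∫⁻ _, C ^ (p : ℝ) ∂ν := by
        refine lintegral_mono_ae ?_
        filter_upwards [hC] with y hy
        rw [← eLpNorm_nnreal_pow_eq_lintegral hp0.ne']
        gcongr
    _ = C ^ (p : ℝ) := by simp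

end Lp

section Affine

theorem eventually_forall_comp_smul_add_eq_zero {X F ι : Type*} [NormedAddCommGroup X]
    [NormedSpace ℝ X] [Zero F] {l : Filter ι} {c : ι → ℝ} {a : ι → X} {g : X → F}
    (hg : HasCompactSupport g) (hc : Tendsto c l (𝓝 1)) (ha : Tendsto a l (𝓝 0)) :
    ∃ M, ∀ᶠ i in l, ∀ x, M < ‖x‖ → g (c i • x + a i) = 0 := by
  obtain ⟨M, hM0, hM⟩ := hg.exists_pos_le_norm
  refine ⟨2 * (M + 1), ?_⟩
  filter_upwards [hc.eventually_const_lt (show (1 / 2 : ℝ) < 1 by norm_num),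
    ha.norm.eventually_lt_const (show ‖(0 : X)‖ < 1 by simp)] with i hci hai x hx
  refine hM _ ?_
  have htri : ‖c i • x‖ - ‖a i‖ ≤ ‖c i • x + a i‖ := by
    simpa using norm_sub_norm_le (c i • x) (-a i)
  rw [norm_smul, Real.norm_eq_abs, abs_of_pos (by linarith)] at htri
  nlinarith

variable {X F ι : Type*} [NormedAddCommGroup X] [NormedSpace ℝ X] [FiniteDimensional ℝ X]
  [MeasurableSpace X] [BorelSpace X] [NormedAddCommGroup F] {μ : Measure X}
  [μ.IsAddHaarMeasure] {p : ℝ≥0∞} {r : ℝ}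

theorem map_smul_add_addHaar (hr : r ≠ 0) (b : X) :
    μ.map (fun x => r • x + b) = ENNReal.ofReal |(r ^ Module.finrank ℝ X)⁻¹| • μ := by
  have hcomp : (fun x : X => r • x + b) = (· + b) ∘ (r • ·) := rfl
  rw [hcomp, ← Measure.map_map (by fun_prop) (by fun_prop), Measure.map_addHaar_smul μ hr,
    Measure.map_smul, map_add_right_eq_self]

theorem quasiMeasurePreserving_smul_add (hr : r ≠ 0) (b : X) :
    Measure.QuasiMeasurePreserving (fun x => r • x + b) μ μ :=
  ⟨by fun_prop, by rw [map_smul_add_addHaar hr]; exact Measure.smul_absolutelyContinuous⟩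

theorem eLpNorm_comp_smul_add {f : X → F} (hf : AEStronglyMeasurable f μ) (hp : p ≠ ∞)
    (hr : r ≠ 0) (b : X) :
    eLpNorm (fun x => f (r • x + b)) p μ =
      ENNReal.ofReal |(r ^ Module.finrank ℝ X)⁻¹| ^ (1 / p.toReal) * eLpNorm f p μ := by
  have hf' : AEStronglyMeasurable f (μ.map fun x => r • x + b) := by
    rw [map_smul_add_addHaar hr]
    exact hf.smul_measure _
  have hcomp := eLpNorm_map_measure (p := p) hf' (by fun_prop)
  rw [map_smul_add_addHaar hr, eLpNorm_smul_measure_of_ne_top hp] at hcomp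
  simpa [Function.comp_def] using hcomp.symm

theorem memLp_comp_smul_add {f : X → F} (hf : MemLp f p μ) (hr : r ≠ 0) (b : X) :
    MemLp (fun x => f (r • x + b)) p μ := by
  have hf' : MemLp f p (μ.map fun x => r • x + b) := by
    rw [map_smul_add_addHaar hr]
    exact hf.smul_measure ENNReal.ofReal_ne_top
  exact hf'.comp_of_map (by fun_prop)

variable {l : Filter ι} {c : ι → ℝ} {a : ι → X}

theorem eventually_eLpNorm_comp_smul_add_le (hp : p ≠ ∞) (hc : Tendsto c l (𝓝 1)) :
    ∀ᶠ i in l, ∀ f : X → F, AEStronglyMeasurable f μ →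
      eLpNorm (fun x => f (c i • x + a i)) p μ ≤ 2 * eLpNorm f p μ := by
  have hfactor : Tendsto
      (fun i => ENNReal.ofReal |(c i ^ Module.finrank ℝ X)⁻¹| ^ (1 / p.toReal)) l (𝓝 1) := by
    have hdet : Tendsto (fun i => |(c i ^ Module.finrank ℝ X)⁻¹|) l (𝓝 1) := by
      simpa using ((hc.pow (Module.finrank ℝ X)).inv₀ (by simp)).abs
    simpa using (ENNReal.tendsto_ofReal hdet).ennrpow_const (1 / p.toReal)
  filter_upwards [hc.eventually_ne one_ne_zero,
    hfactor.eventually_le_const ENNReal.one_lt_two] with i hi0 hi2 f hf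
  rw [eLpNorm_comp_smul_add hf hp hi0]
  gcongr

variable [l.IsCountablyGenerated]

theorem tendsto_eLpNorm_comp_smul_add_sub_of_hasCompactSupport {g : X → F} (hg : Continuous g)
    (hgc : HasCompactSupport g) (hp : p ≠ ∞) (hc : Tendsto c l (𝓝 1)) (ha : Tendsto a l (𝓝 0)) :
    Tendsto (fun i => eLpNorm (fun x => g (c i • x + a i) - g x) p μ) l (𝓝 0) := by
  obtain ⟨C, hC⟩ := hgc.exists_bound_of_continuous hg
  obtain ⟨M, -, hM⟩ := hgc.exists_pos_le_norm
  obtain ⟨M', hM'⟩ := eventually_forall_comp_smul_add_eq_zero hgc hc ha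
  refine tendsto_eLpNorm_zero_of_dominated
    (g := (closedBall (0 : X) (max M M')).indicator fun _ => C + C) hp
    (.of_forall fun i => ?_) ?_ ?_ (.of_forall fun x => ?_)
  · exact ((hg.comp (by fun_prop)).sub hg).aestronglyMeasurable
  · exact memLp_indicator_const p measurableSet_closedBall _
      (.inr (isCompact_closedBall _ _).measure_ne_top)
  · filter_upwards [hM'] with i hi
    refine .of_forall fun x => ?_
    by_cases hx : x ∈ closedBall (0 : X) (max M M')
    · rw [Set.indicator_of_mem hx]
      exact norm_sub_le_of_le (hC _) (hC _)
    · rw [Set.indicator_of_notMem hx]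
      rw [mem_closedBall_zero_iff, not_le, max_lt_iff] at hx
      simp [hi x hx.2, hM x hx.1.le]
  · have hx : Tendsto (fun i => c i • x + a i) l (𝓝 x) := by
      simpa using (hc.smul_const x).add ha
    simpa using ((hg.tendsto x).comp hx).sub_const (g x)

theorem tendsto_eLpNorm_comp_smul_add_sub [NormedSpace ℝ F] {f : X → F} (hp1 : 1 ≤ p)
    (hp : p ≠ ∞) (hf : MemLp f p μ) (hc : Tendsto c l (𝓝 1)) (ha : Tendsto a l (𝓝 0)) :
    Tendsto (fun i => eLpNorm (fun x => f (c i • x + a i) - f x) p μ) l (𝓝 0) := by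
  refine ENNReal.tendsto_nhds_zero.2 fun ε hε => ?_
  have hε4 : 0 < ε / 4 := ENNReal.div_pos hε.ne' (by simp)
  obtain ⟨g, hgc, hfg, hg, hgp⟩ := hf.exists_hasCompactSupport_eLpNorm_sub_le hp hε4.ne'
  have hfg_meas : AEStronglyMeasurable (f - g) μ := hf.1.sub hgp.1
  filter_upwards [hc.eventually_ne one_ne_zero,
    eventually_eLpNorm_comp_smul_add_le (F := F) (μ := μ) (a := a) hp hc,
    ENNReal.tendsto_nhds_zero.1
      (tendsto_eLpNorm_comp_smul_add_sub_of_hasCompactSupport (μ := μ) hg hgc hp hc ha) _ hε4]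
    with i hi0 hi hgi
  have hdecomp : (fun x => f (c i • x + a i) - f x) = (fun x => (f - g) (c i • x + a i)) +
      (fun x => g (c i • x + a i) - g x) - (f - g) := by
    ext x
    simp
  have hmeas₁ : AEStronglyMeasurable (fun x => (f - g) (c i • x + a i)) μ :=
    hfg_meas.comp_quasiMeasurePreserving (quasiMeasurePreserving_smul_add hi0 (a i))
  have hmeas₂ : AEStronglyMeasurable (fun x => g (c i • x + a i) - g x) μ :=
    ((hg.comp (by fun_prop)).sub hg).aestronglyMeasurable
  calc eLpNorm (fun x => f (c i • x + a i) - f x) p μ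
      ≤ eLpNorm (fun x => (f - g) (c i • x + a i)) p μ +
          eLpNorm (fun x => g (c i • x + a i) - g x) p μ + eLpNorm (f - g) p μ := by
        rw [hdecomp]
        exact (eLpNorm_sub_le (hmeas₁.add hmeas₂) hfg_meas hp1).trans
          (by gcongr; exact eLpNorm_add_le hmeas₁ hmeas₂ hp1)
    _ ≤ 2 * (ε / 4) + ε / 4 + ε / 4 := by
        gcongr
        exact (hi _ hfg_meas).trans (by gcongr)
    _ = 4 * (ε / 4) := by ring
    _ = ε := ENNReal.mul_div_cancel (by simp) (by simp)

end Affine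

section DiffQuot

variable {E : Type*} [NormedAddCommGroup E]

/-- The difference quotient `(u x - u y) / |x - y| ^ a`, as a function of the pair `(x, y)`. Its
`L^p` norm is the Gagliardo seminorm of order `s` when `a = N / p + s`. -/
noncomputable def diffQuot (a : ℝ) (u : E → ℝ) (z : E × E) : ℝ :=
  (u z.1 - u z.2) / ‖z.1 - z.2‖ ^ a

variable {a : ℝ} {u v : E → ℝ}

theorem diffQuot_sub (a : ℝ) (u v : E → ℝ) :
    diffQuot a (u - v) = diffQuot a u - diffQuot a v := by
  ext z
  simp only [diffQuot, Pi.sub_apply]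
  ring

theorem diffQuot_mul (η u : E → ℝ) (z : E × E) :
    diffQuot a (η * u) z = η z.1 * diffQuot a u z + u z.2 * diffQuot a η z := by
  simp only [diffQuot, Pi.mul_apply]
  ring

theorem diffQuot_comp_smul [NormedSpace ℝ E] {c : ℝ} (hc : 0 < c) (z : E × E) :
    diffQuot a (fun x => u (c • x)) z = c ^ a * diffQuot a u (c • z) := by
  have hca : c ^ a ≠ 0 := (Real.rpow_pos_of_pos hc a).ne'
  simp only [diffQuot, Prod.smul_fst, Prod.smul_snd, ← smul_sub, norm_smul,
    Real.norm_of_nonneg hc.le]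
  rw [Real.mul_rpow hc.le (norm_nonneg _), ← mul_div_assoc, mul_div_mul_left _ _ hca]

theorem norm_diffQuot_comp_le {T : ℝ → ℝ} {K : NNReal} (hT : LipschitzWith K T) (z : E × E) :
    ‖diffQuot a (T ∘ u) z‖ ≤ K * ‖diffQuot a u z‖ := by
  simp only [diffQuot, norm_div, Function.comp_apply, ← mul_div_assoc]
  gcongr
  exact hT.norm_sub_le _ _

theorem norm_diffQuot_le_min {η : E → ℝ} (hη : LipschitzWith 1 η)
    (hη01 : ∀ x, η x ∈ Set.Icc (0 : ℝ) 1) (z : E × E) :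
    ‖diffQuot a η z‖ ≤ min 1 ‖z.1 - z.2‖ / ‖z.1 - z.2‖ ^ a := by
  have hlip : |η z.1 - η z.2| ≤ ‖z.1 - z.2‖ := by
    simpa using hη.norm_sub_le z.1 z.2
  have hone : |η z.1 - η z.2| ≤ 1 := by
    simpa using abs_sub_le_of_le_of_le (hη01 z.1).1 (hη01 z.1).2 (hη01 z.2).1 (hη01 z.2).2
  rw [diffQuot, norm_div, Real.norm_of_nonneg (Real.rpow_nonneg (norm_nonneg _) a)]
  gcongr
  exact le_min hone hlip

theorem norm_diffQuot_mul_sub_le {η : E → ℝ} (hη : LipschitzWith 1 η)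
    (hη01 : ∀ x, η x ∈ Set.Icc (0 : ℝ) 1) (z : E × E) :
    ‖diffQuot a (η * u - u) z‖ ≤
      ‖diffQuot a u z‖ + ‖min 1 ‖z.1 - z.2‖ / ‖z.1 - z.2‖ ^ a * u z.2‖ := by
  have hsplit : diffQuot a (η * u - u) z =
      (η z.1 - 1) * diffQuot a u z + diffQuot a η z * u z.2 := by
    rw [diffQuot_sub, Pi.sub_apply, diffQuot_mul]
    ring
  have hη1 : ‖η z.1 - 1‖ ≤ 1 := by
    rw [Real.norm_eq_abs, abs_le]
    constructor <;> linarith [(hη01 z.1).1, (hη01 z.1).2]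
  rw [hsplit]
  refine norm_add_le_of_le ?_ ?_
  · rw [norm_mul]
    exact mul_le_of_le_one_left (norm_nonneg _) hη1
  · rw [norm_mul, norm_mul]
    gcongr
    exact (norm_diffQuot_le_min hη hη01 z).trans (le_abs_self _)

theorem tendsto_diffQuot_sub {ι : Type*} {l : Filter ι} {v : ι → E → ℝ}
    (hv : ∀ x, Tendsto (fun i => v i x) l (𝓝 (u x))) (z : E × E) :
    Tendsto (fun i => diffQuot a (v i - u) z) l (𝓝 0) := by
  have hsub (x : E) : Tendsto (fun i => v i x - u x) l (𝓝 0) := by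
    simpa using (hv x).sub_const (u x)
  simpa [diffQuot] using ((hsub z.1).sub (hsub z.2)).div_const (‖z.1 - z.2‖ ^ a)

variable [MeasurableSpace E]

theorem memLp_diffQuot_of_sub {p : ℝ≥0∞} {μ : Measure (E × E)}
    (hvu : MemLp (diffQuot a (v - u)) p μ) (hu : MemLp (diffQuot a u) p μ) :
    MemLp (diffQuot a v) p μ := by
  simpa [diffQuot_sub] using hvu.add hu

variable [BorelSpace E] [SecondCountableTopology E]

theorem measurable_diffQuot (hu : Measurable u) : Measurable (diffQuot a u) := by
  unfold diffQuot
  fun_prop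

theorem eLpNorm_diffQuot_sub_le {p : ℝ≥0∞} {μ : Measure (E × E)} {w : E → ℝ} (hp1 : 1 ≤ p)
    (hu : Measurable u) (hv : Measurable v) (hw : Measurable w) :
    eLpNorm (diffQuot a (u - w)) p μ ≤
      eLpNorm (diffQuot a (u - v)) p μ + eLpNorm (diffQuot a (v - w)) p μ := by
  have hsplit : diffQuot a (u - w) = diffQuot a (u - v) + diffQuot a (v - w) := by
    simp only [diffQuot_sub, sub_add_sub_cancel]
  rw [hsplit]
  exact eLpNorm_add_le (measurable_diffQuot (hu.sub hv)).aestronglyMeasurable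
    (measurable_diffQuot (hv.sub hw)).aestronglyMeasurable hp1

theorem tendsto_eLpNorm_diffQuot_comp_sub {ι : Type*} {l : Filter ι} [l.IsCountablyGenerated]
    {p : ℝ≥0∞} {μ : Measure (E × E)} {T : ι → ℝ → ℝ} {K : NNReal} (hp : p ≠ ∞)
    (hT : ∀ i, LipschitzWith K (T i)) (hTlim : ∀ t, Tendsto (fun i => T i t) l (𝓝 t))
    (hu : Measurable u) (huE : MemLp (diffQuot a u) p μ) :
    Tendsto (fun i => eLpNorm (diffQuot a (T i ∘ u - u)) p μ) l (𝓝 0) := by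
  refine tendsto_eLpNorm_zero_of_dominated (g := fun z => (K + 1) * ‖diffQuot a u z‖) hp
    (.of_forall fun i => ?_) (huE.norm.const_mul _) (.of_forall fun i => .of_forall fun z => ?_)
    (.of_forall <| tendsto_diffQuot_sub fun x => hTlim (u x))
  · exact (measurable_diffQuot
      (((hT i).continuous.measurable.comp hu).sub hu)).aestronglyMeasurable
  · rw [diffQuot_sub, add_one_mul]
    exact norm_sub_le_of_le (norm_diffQuot_comp_le (hT i) z) le_rfl

end DiffQuot

section Cutoff

theorem memLp_mul_prod {X Y : Type*} [MeasurableSpace X] [MeasurableSpace Y] {μ : Measure X}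
    {ν : Measure Y} [SFinite μ] [SFinite ν] {p : ℝ≥0∞} {f : X → ℝ} {g : Y → ℝ} (hp0 : p ≠ 0)
    (hp : p ≠ ∞) (hf : MemLp f p μ) (hg : MemLp g p ν) :
    MemLp (fun z : X × Y => f z.1 * g z.2) p (μ.prod ν) := by
  refine (integrable_norm_rpow_iff (hf.1.comp_fst.fun_mul hg.1.comp_snd) hp0 hp).1 ?_
  have hint := (hf.integrable_norm_rpow hp0 hp).mul_prod (hg.integrable_norm_rpow hp0 hp)
  refine hint.congr (.of_forall fun z => ?_)
  simp only [norm_mul]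
  rw [Real.mul_rpow (norm_nonneg _) (norm_nonneg _)]

variable {E : Type*} [NormedAddCommGroup E] [MeasurableSpace E] [BorelSpace E]

theorem memLp_min_one_norm_div_rpow [NormedSpace ℝ E] [FiniteDimensional ℝ E] [Nontrivial E]
    {μ : Measure E} [μ.IsAddHaarMeasure] {a : ℝ} {p : ℝ≥0∞} (hp0 : p ≠ 0) (hp : p ≠ ∞)
    (ha : (Module.finrank ℝ E : ℝ) < a * p.toReal)
    (ha' : (a - 1) * p.toReal < Module.finrank ℝ E) :
    MemLp (fun z : E => min 1 ‖z‖ / ‖z‖ ^ a) p μ := by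
  have hmeas : Measurable fun z : E => min 1 ‖z‖ / ‖z‖ ^ a := by fun_prop
  rw [← integrable_norm_rpow_iff hmeas.aestronglyMeasurable hp0 hp, integrable_fun_norm_addHaar μ
    (f := fun r : ℝ => ‖min 1 r / r ^ a‖ ^ p.toReal), ← Set.Ioc_union_Ioi_eq_Ioi zero_le_one]
  have hpow (r : ℝ) :
      r ^ (Module.finrank ℝ E - 1) = r ^ ((Module.finrank ℝ E : ℝ) - 1) := by
    rw [← Real.rpow_natCast, Nat.cast_pred Module.finrank_pos]
  have hnear : IntegrableOn (fun r : ℝ => r ^ ((Module.finrank ℝ E : ℝ) - 1 + (1 - a) * p.toReal))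
      (Set.Ioc 0 1) :=
    (intervalIntegrable_iff_integrableOn_Ioc_of_le zero_le_one).1
      (intervalIntegral.intervalIntegrable_rpow' (by linarith))
  have hfar : IntegrableOn (fun r : ℝ => r ^ ((Module.finrank ℝ E : ℝ) - 1 + (-a) * p.toReal))
      (Set.Ioi 1) :=
    integrableOn_Ioi_rpow_of_lt (by linarith) one_pos
  refine .union (hnear.congr_fun (fun r hr => ?_) measurableSet_Ioc)
    (hfar.congr_fun (fun r hr => ?_) measurableSet_Ioi)
  · have hquot : min 1 r / r ^ a = r ^ (1 - a) := by
      rw [min_eq_right hr.2, Real.rpow_sub hr.1, Real.rpow_one]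
    dsimp only
    rw [hquot, Real.norm_of_nonneg (Real.rpow_nonneg hr.1.le _), hpow r, smul_eq_mul,
      ← Real.rpow_mul hr.1.le, ← Real.rpow_add hr.1]
  · have hr0 : 0 < r := one_pos.trans hr
    have hquot : min 1 r / r ^ a = r ^ (-a) := by
      rw [min_eq_left (le_of_lt hr), Real.rpow_neg hr0.le, one_div]
    dsimp only
    rw [hquot, Real.norm_of_nonneg (Real.rpow_nonneg hr0.le _), hpow r, smul_eq_mul,
      ← Real.rpow_mul hr0.le, ← Real.rpow_add hr0]

variable [SecondCountableTopology E]

theorem tendsto_eLpNorm_diffQuot_mul_sub {ι : Type*} {l : Filter ι} [l.IsCountablyGenerated]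
    {μ : Measure E} [SFinite μ] [μ.IsAddRightInvariant] {a : ℝ} {p : ℝ≥0∞} {u : E → ℝ}
    {η : ι → E → ℝ} (hp0 : p ≠ 0) (hp : p ≠ ∞)
    (hker : MemLp (fun z : E => min 1 ‖z‖ / ‖z‖ ^ a) p μ)
    (hη : ∀ i, LipschitzWith 1 (η i)) (hη01 : ∀ i x, η i x ∈ Set.Icc (0 : ℝ) 1)
    (hηlim : ∀ x, Tendsto (fun i => η i x) l (𝓝 1))
    (hu : Measurable u) (hup : MemLp u p μ) (huE : MemLp (diffQuot a u) p (μ.prod μ)) :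
    Tendsto (fun i => eLpNorm (diffQuot a (η i * u - u)) p (μ.prod μ)) l (𝓝 0) := by
  let k (z : E) : ℝ := min 1 ‖z‖ / ‖z‖ ^ a
  have hbound : MemLp (fun z : E × E => ‖k (z.1 - z.2) * u z.2‖) p (μ.prod μ) :=
    ((memLp_mul_prod hp0 hp hker hup).comp_measurePreserving
      (measurePreserving_sub_prod μ μ)).norm
  refine tendsto_eLpNorm_zero_of_dominated
    (g := fun z => ‖diffQuot a u z‖ + ‖k (z.1 - z.2) * u z.2‖) hp
    (.of_forall fun i => ?_) (huE.norm.add hbound) (.of_forall fun i => .of_forall fun z => ?_)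
    (.of_forall <| tendsto_diffQuot_sub fun x => ?_)
  · exact (measurable_diffQuot
      (((hη i).continuous.measurable.mul hu).sub hu)).aestronglyMeasurable
  · exact norm_diffQuot_mul_sub_le (hη i) (hη01 i) z
  · simpa using (hηlim x).mul_const (u x)

end Cutoff

section Dilation

variable {E ι : Type*} [NormedAddCommGroup E] [NormedSpace ℝ E] [FiniteDimensional ℝ E]
  [MeasurableSpace E] [BorelSpace E] {μ : Measure E} [μ.IsAddHaarMeasure] {p : ℝ≥0∞} {a : ℝ}
  {u : E → ℝ} {l : Filter ι} [l.IsCountablyGenerated]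

theorem tendsto_eLpNorm_diffQuot_comp_smul_sub {c : ι → ℝ} (hp1 : 1 ≤ p) (hp : p ≠ ∞)
    (hc0 : ∀ i, 0 < c i) (hc : Tendsto c l (𝓝 1)) (hu : Measurable u)
    (huE : MemLp (diffQuot a u) p (μ.prod μ)) :
    Tendsto (fun i => eLpNorm (diffQuot a ((fun x => u (c i • x)) - u)) p (μ.prod μ)) l
      (𝓝 0) := by
  have hsplit (i : ι) : diffQuot a ((fun x => u (c i • x)) - u) =
      c i ^ a • (fun z => diffQuot a u (c i • z) - diffQuot a u z) +
        (c i ^ a - 1) • diffQuot a u := by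
    ext z
    simp only [diffQuot_sub, Pi.sub_apply, diffQuot_comp_smul (hc0 i), Pi.add_apply,
      Pi.smul_apply, smul_eq_mul]
    ring
  have hca : Tendsto (fun i => c i ^ a) l (𝓝 1) := by
    simpa using hc.rpow_const (p := a) (.inl one_ne_zero)
  have hdil : Tendsto (fun i => eLpNorm (fun z => diffQuot a u (c i • z) - diffQuot a u z) p
      (μ.prod μ)) l (𝓝 0) := by
    simpa using tendsto_eLpNorm_comp_smul_add_sub hp1 hp huE hc (tendsto_const_nhds (x := 0))
  have hupper : Tendsto (fun i => ‖c i ^ a‖ₑ * eLpNorm (fun z => diffQuot a u (c i • z) -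
      diffQuot a u z) p (μ.prod μ) + ‖c i ^ a - 1‖ₑ * eLpNorm (diffQuot a u) p (μ.prod μ)) l
      (𝓝 0) := by
    have hfst := ENNReal.Tendsto.mul hca.enorm (.inr (by simp)) hdil (.inr (by simp))
    have hsnd := ENNReal.Tendsto.mul_const (hca.sub_const 1).enorm (.inr huE.eLpNorm_ne_top)
    simpa using hfst.add hsnd
  refine tendsto_of_tendsto_of_tendsto_of_le_of_le tendsto_const_nhds hupper
    (fun _ => zero_le) fun i => ?_
  have hm : Measurable (diffQuot a u) := measurable_diffQuot hu
  have hmc : Measurable fun z => diffQuot a u (c i • z) := hm.comp (by fun_prop)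
  rw [hsplit, ← eLpNorm_const_smul, ← eLpNorm_const_smul]
  exact eLpNorm_add_le ((hmc.sub hm).const_smul _).aestronglyMeasurable
    (hm.const_smul _).aestronglyMeasurable hp1

end Dilation

section Mollification

variable {E : Type*} [NormedAddCommGroup E] [MeasurableSpace E] {μ : Measure E} {p : ℝ≥0∞}
  {a : ℝ} {u : E → ℝ}

theorem diffQuot_average_sub {ν : Measure E} [IsProbabilityMeasure ν]
    (hν : ∀ x, Integrable (fun h => u (x - h)) ν) (z : E × E) :
    diffQuot a ((fun x => ∫ h, u (x - h) ∂ν) - u) z =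
      ∫ h, (diffQuot a u (z - (h, h)) - diffQuot a u z) ∂ν := by
  have hquot (h : E) : diffQuot a u (z - (h, h)) =
      (u (z.1 - h) - u (z.2 - h)) / ‖z.1 - z.2‖ ^ a := by
    simp only [diffQuot, Prod.fst_sub, Prod.snd_sub, sub_sub_sub_cancel_right]
  have hint : Integrable (fun h => u (z.1 - h) - u (z.2 - h)) ν := (hν _).sub (hν _)
  simp only [hquot]
  rw [integral_sub (hint.div_const _) (integrable_const _), integral_div,
    integral_sub (hν _) (hν _), integral_const, probReal_univ, one_smul, diffQuot_sub]
  rfl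

theorem eLpNorm_diffQuot_average_sub_le [BorelSpace E] [SecondCountableTopology E] [SFinite μ]
    {ν : Measure E} [IsProbabilityMeasure ν] (hp1 : 1 ≤ p) (hp : p ≠ ∞) (hu : Measurable u)
    (hν : ∀ x, Integrable (fun h => u (x - h)) ν) {C : ℝ≥0∞}
    (hC : ∀ᵐ h ∂ν,
      eLpNorm (fun z => diffQuot a u (z - (h, h)) - diffQuot a u z) p (μ.prod μ) ≤ C) :
    eLpNorm (diffQuot a ((fun x => ∫ h, u (x - h) ∂ν) - u)) p (μ.prod μ) ≤ C := by
  rw [funext (diffQuot_average_sub hν)]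
  have hm : Measurable (diffQuot a u) := measurable_diffQuot hu
  refine eLpNorm_integral_le_of_ae_le hp1 hp (Measurable.aestronglyMeasurable ?_) hC
  exact (hm.comp (by fun_prop)).sub (hm.comp measurable_fst)

end Mollification

section Bump

open scoped Convolution

variable {E : Type*} [NormedAddCommGroup E] [NormedSpace ℝ E] [FiniteDimensional ℝ E]
  [MeasurableSpace E] [BorelSpace E] {μ : Measure E}

/-- The probability measure whose density is a normalized bump function, so that mollification is
averaging over translations. -/
noncomputable def bumpMeasure (φ : ContDiffBump (0 : E)) (μ : Measure E) : Measure E :=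
  μ.withDensity fun h => ENNReal.ofReal (φ.normed μ h)

variable (φ : ContDiffBump (0 : E))

theorem integral_sub_bumpMeasure (u : E → ℝ) (x : E) :
    ∫ h, u (x - h) ∂bumpMeasure φ μ = (φ.normed μ ⋆[ContinuousLinearMap.lsmul ℝ ℝ, μ] u) x := by
  rw [bumpMeasure, integral_withDensity_eq_integral_toReal_smul
    φ.continuous_normed.measurable.ennreal_ofReal (by simp)]
  simp [convolution_def, ENNReal.toReal_ofReal (φ.nonneg_normed _)]

variable [μ.IsAddHaarMeasure]

instance isProbabilityMeasure_bumpMeasure : IsProbabilityMeasure (bumpMeasure φ μ) :=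
  ⟨by rw [bumpMeasure, withDensity_apply _ MeasurableSet.univ, Measure.restrict_univ,
    ← ofReal_integral_eq_lintegral_ofReal φ.integrable_normed (.of_forall φ.nonneg_normed),
    φ.integral_normed, ENNReal.ofReal_one]⟩

theorem ae_bumpMeasure_mem_ball : ∀ᵐ h ∂bumpMeasure φ μ, h ∈ ball 0 φ.rOut := by
  rw [bumpMeasure, ae_withDensity_iff φ.continuous_normed.measurable.ennreal_ofReal]
  refine .of_forall fun h hh => ?_
  rw [← φ.support_normed_eq (μ := μ)]
  rintro h0
  simp [h0] at hh

theorem integrable_sub_bumpMeasure {u : E → ℝ} (hu : LocallyIntegrable u μ) (x : E) :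
    Integrable (fun h => u (x - h)) (bumpMeasure φ μ) := by
  rw [bumpMeasure, integrable_withDensity_iff_integrable_smul'
    φ.continuous_normed.measurable.ennreal_ofReal (by simp)]
  simpa [ENNReal.toReal_ofReal (φ.nonneg_normed _), ConvolutionExistsAt] using
    φ.hasCompactSupport_normed.convolutionExists_left (ContinuousLinearMap.lsmul ℝ ℝ)
      φ.continuous_normed hu x

theorem tendsto_eLpNorm_diffQuot_convolution_sub {ι : Type*} {l : Filter ι} {p : ℝ≥0∞} {a : ℝ}
    {u : E → ℝ} {φ : ι → ContDiffBump (0 : E)} (hp1 : 1 ≤ p) (hp : p ≠ ∞)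
    (hφ : Tendsto (fun i => (φ i).rOut) l (𝓝 0)) (hu : Measurable u)
    (hloc : LocallyIntegrable u μ) (huE : MemLp (diffQuot a u) p (μ.prod μ)) :
    Tendsto (fun i => eLpNorm (diffQuot a
      (((φ i).normed μ ⋆[ContinuousLinearMap.lsmul ℝ ℝ, μ] u) - u)) p (μ.prod μ)) l (𝓝 0) := by
  have htrans : Tendsto (fun h : E => eLpNorm
      (fun z => diffQuot a u (z - (h, h)) - diffQuot a u z) p (μ.prod μ)) (𝓝 0) (𝓝 0) := by
    have hneg : Tendsto (fun h : E => -(h, h)) (𝓝 0) (𝓝 0) :=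
      Continuous.tendsto' (by fun_prop) _ _ (by simp)
    simpa [sub_eq_add_neg] using
      tendsto_eLpNorm_comp_smul_add_sub hp1 hp huE (tendsto_const_nhds (x := 1)) hneg
  refine ENNReal.tendsto_nhds_zero.2 fun ε hε => ?_
  obtain ⟨δ, hδ, hball⟩ := Metric.eventually_nhds_iff_ball.1
    (ENNReal.tendsto_nhds_zero.1 htrans ε hε)
  filter_upwards [hφ.eventually_lt_const hδ] with i hi
  rw [← funext (integral_sub_bumpMeasure (φ i) u)]
  refine eLpNorm_diffQuot_average_sub_le hp1 hp hu (integrable_sub_bumpMeasure (φ i) hloc) ?_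
  filter_upwards [ae_bumpMeasure_mem_ball (φ i)] with h hh
  exact hball h (ball_subset_ball hi.le hh)

end Bump

section Truncation

/-- Truncation of a real number at heights `-r` and `r`. -/
def clamp (r t : ℝ) : ℝ := max (-r) (min r t)

theorem lipschitzWith_clamp (r : ℝ) : LipschitzWith 1 (clamp r) :=
  (LipschitzWith.id.const_min r).const_max (-r)

theorem clamp_of_abs_le {r t : ℝ} (h : |t| ≤ r) : clamp r t = t := by
  rw [clamp, min_eq_right (abs_le.1 h).2, max_eq_right (abs_le.1 h).1]

theorem abs_clamp_le {r : ℝ} (hr : 0 ≤ r) (t : ℝ) : |clamp r t| ≤ r :=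
  abs_le.2 ⟨le_max_left _ _, max_le (neg_le_self hr) (min_le_left _ _)⟩

theorem clamp_le_clamp {r r' t : ℝ} (hr : 0 ≤ r) (hrr' : r ≤ r') (ht : 0 ≤ t) :
    clamp r t ≤ clamp r' t := by
  have hmin : -r ≤ min r t := le_min (neg_le_self hr) ((neg_nonpos.2 hr).trans ht)
  rw [clamp, max_eq_right hmin]
  exact (min_le_min_right t hrr').trans (le_max_right _ _)

/-- The part of a real number between the heights `1 / (n + 1)` and `n + 1`. Composing a function
with it removes both its peaks and its tail. -/
noncomputable def bandTrunc (n : ℕ) (t : ℝ) : ℝ := clamp (n + 1) t - clamp (n + 1 : ℝ)⁻¹ t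

theorem inv_natCast_succ_le (n : ℕ) : (n + 1 : ℝ)⁻¹ ≤ n + 1 := by
  have hn : (1 : ℝ) ≤ n + 1 := by simp
  exact (inv_le_one_of_one_le₀ hn).trans hn

theorem lipschitzWith_bandTrunc (n : ℕ) : LipschitzWith 2 (bandTrunc n) := by
  rw [← one_add_one_eq_two]
  exact (lipschitzWith_clamp _).sub (lipschitzWith_clamp _)

theorem abs_bandTrunc_le (n : ℕ) (t : ℝ) : |bandTrunc n t| ≤ (n + 1) + (n + 1 : ℝ)⁻¹ :=
  (abs_sub _ _).trans (add_le_add (abs_clamp_le (by positivity) t) (abs_clamp_le (by positivity) t))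

theorem bandTrunc_of_abs_le {n : ℕ} {t : ℝ} (ht : |t| ≤ (n + 1 : ℝ)⁻¹) : bandTrunc n t = 0 := by
  rw [bandTrunc, clamp_of_abs_le ht, clamp_of_abs_le (ht.trans (inv_natCast_succ_le n)), sub_self]

theorem bandTrunc_nonneg (n : ℕ) {t : ℝ} (ht : 0 ≤ t) : 0 ≤ bandTrunc n t :=
  sub_nonneg.2 (clamp_le_clamp (by positivity) (inv_natCast_succ_le n) ht)

theorem tendsto_bandTrunc (t : ℝ) : Tendsto (fun n => bandTrunc n t) atTop (𝓝 t) := by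
  have hlow : Tendsto (fun n : ℕ => clamp (n + 1 : ℝ)⁻¹ t) atTop (𝓝 0) :=
    squeeze_zero_norm (fun n => abs_clamp_le (by positivity) t)
      (by simpa using tendsto_one_div_add_atTop_nhds_zero_nat (𝕜 := ℝ))
  have hhigh : ∀ᶠ n : ℕ in atTop, clamp (n + 1 : ℝ) t = t := by
    filter_upwards [eventually_ge_atTop ⌈|t|⌉₊] with n hn
    exact clamp_of_abs_le ((Nat.ceil_le.1 hn).trans (by simp))
  simpa [bandTrunc] using (tendsto_nhds_of_eventually_eq hhigh).sub hlow

theorem memLp_bandTrunc_comp {X : Type*} [MeasurableSpace X] {μ : Measure X} {u : X → ℝ}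
    (hu : AEStronglyMeasurable u μ) (huv : ∀ ε : NNReal, ε ≠ 0 → μ {x | ε ≤ ‖u x‖₊} < ∞)
    (p : ℝ≥0∞) (n : ℕ) : MemLp (bandTrunc n ∘ u) p μ := by
  have hsupport (x : X) (hx : x ∉ {x | (n + 1 : NNReal)⁻¹ ≤ ‖u x‖₊}) :
      (bandTrunc n ∘ u) x = 0 := by
    refine bandTrunc_of_abs_le ?_
    rw [Set.mem_ofPred_eq, not_le] at hx
    exact_mod_cast hx.le
  have hbdd : MemLp (bandTrunc n ∘ u) ∞ μ :=
    memLp_top_of_bound ((lipschitzWith_bandTrunc n).continuous.comp_aestronglyMeasurable hu) _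
      (.of_forall fun x => abs_bandTrunc_le n (u x))
  exact hbdd.mono_exponent_of_measure_support_ne_top hsupport
    (huv _ (by positivity)).ne le_top

end Truncation

section RadialCutoff

variable {E : Type*} [NormedAddCommGroup E]

/-- The radial cutoff function equal to `1` where `|x| ≤ r - 1` and to `0` where `r ≤ |x|`. -/
noncomputable def radialCutoff (r : ℝ) (x : E) : ℝ := max 0 (min 1 (r - ‖x‖))

theorem lipschitzWith_radialCutoff (r : ℝ) : LipschitzWith 1 (radialCutoff (E := E) r) := by
  have hsub : LipschitzWith 1 fun x : E => r - ‖x‖ := by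
    simpa using (LipschitzWith.const r).sub (lipschitzWith_one_norm (E := E))
  exact (hsub.const_min 1).const_max 0

theorem radialCutoff_mem_Icc (r : ℝ) (x : E) : radialCutoff r x ∈ Set.Icc (0 : ℝ) 1 :=
  ⟨le_max_left _ _, max_le zero_le_one (min_le_left _ _)⟩

theorem tendsto_radialCutoff (x : E) :
    Tendsto (fun n : ℕ => radialCutoff n x) atTop (𝓝 1) := by
  refine tendsto_nhds_of_eventually_eq ?_
  filter_upwards [eventually_ge_atTop ⌈1 + ‖x‖⌉₊] with n hn
  have hn' : 1 ≤ n - ‖x‖ := le_sub_iff_add_le.2 (Nat.ceil_le.1 hn)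
  rw [radialCutoff, min_eq_left hn', max_eq_right zero_le_one]

theorem hasCompactSupport_radialCutoff [ProperSpace E] (r : ℝ) :
    HasCompactSupport (radialCutoff (E := E) r) := by
  refine .intro (isCompact_closedBall 0 r) fun x hx => max_eq_left ?_
  rw [mem_closedBall_zero_iff, not_le] at hx
  exact (min_le_right _ _).trans (sub_nonpos.2 hx.le)

end RadialCutoff

section Approximation

open TopologicalSpace
open scoped Convolution

variable {E : Type*} [NormedAddCommGroup E] [NormedSpace ℝ E] [MeasurableSpace E]

/-- `u` is a limit of test functions on `U` for the `L^p` seminorm of the difference quotient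
`diffQuot a`, by nonnegative ones if `u` is nonnegative. -/
def FracApproximable (a : ℝ) (p : ℝ≥0∞) (μ : Measure E) (U : Opens E) (u : E → ℝ) : Prop :=
  ∀ ε, 0 < ε → ∃ φ : TestFunction U ℝ (⊤ : ℕ∞),
    eLpNorm (diffQuot a (⇑φ - u)) p (μ.prod μ) ≤ ε ∧ (0 ≤ u → 0 ≤ ⇑φ)

variable [FiniteDimensional ℝ E] [BorelSpace E] {μ : Measure E} {p : ℝ≥0∞} {a : ℝ} {U : Opens E}
  {u : E → ℝ}

theorem FracApproximable.of_tendsto {ι : Type*} {l : Filter ι} [l.NeBot] {v : ι → E → ℝ}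
    (hp1 : 1 ≤ p) (hu : Measurable u) (huE : MemLp (diffQuot a u) p (μ.prod μ))
    (hv : ∀ i, Measurable (v i)) (hv0 : 0 ≤ u → ∀ i, 0 ≤ v i)
    (hvu : Tendsto (fun i => eLpNorm (diffQuot a (v i - u)) p (μ.prod μ)) l (𝓝 0))
    (happrox : ∀ i, MemLp (diffQuot a (v i)) p (μ.prod μ) → FracApproximable a p μ U (v i)) :
    FracApproximable a p μ U u := by
  intro ε hε
  have hε2 : 0 < ε / 2 := ENNReal.half_pos hε.ne'
  obtain ⟨i, hi, hitop⟩ := ((ENNReal.tendsto_nhds_zero.1 hvu _ hε2).and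
    (hvu.eventually_lt_const ENNReal.zero_lt_top)).exists
  have hviE : MemLp (diffQuot a (v i)) p (μ.prod μ) :=
    memLp_diffQuot_of_sub ⟨(measurable_diffQuot ((hv i).sub hu)).aestronglyMeasurable, hitop⟩ huE
  obtain ⟨φ, hφ, hφ0⟩ := happrox i hviE _ hε2
  refine ⟨φ, ?_, fun hu0 => hφ0 (hv0 hu0 i)⟩
  have hφm : Measurable φ := φ.continuous.measurable
  calc eLpNorm (diffQuot a (⇑φ - u)) p (μ.prod μ)
      ≤ eLpNorm (diffQuot a (⇑φ - v i)) p (μ.prod μ) +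
          eLpNorm (diffQuot a (v i - u)) p (μ.prod μ) :=
        eLpNorm_diffQuot_sub_le hp1 hφm (hv i) hu
    _ ≤ ε / 2 + ε / 2 := add_le_add hφ hi
    _ = ε := ENNReal.add_halves ε

variable [μ.IsAddHaarMeasure]

theorem tsupport_bump_convolution_subset (φ : ContDiffBump (0 : E)) (u : E → ℝ) :
    tsupport (φ.normed μ ⋆[ContinuousLinearMap.lsmul ℝ ℝ, μ] u) ⊆
      cthickening φ.rOut (tsupport u) := by
  refine closure_minimal ((support_convolution_subset _).trans ?_) isClosed_cthickening
  rintro _ ⟨h, hh, y, hy, rfl⟩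
  rw [φ.support_normed_eq, mem_ball_zero_iff] at hh
  exact mem_cthickening_of_dist_le _ y _ _ (subset_tsupport u hy) (by simpa using hh.le)

theorem FracApproximable.of_hasCompactSupport (hp1 : 1 ≤ p) (hp : p ≠ ∞) (hu : Measurable u)
    (hloc : LocallyIntegrable u μ) (huc : HasCompactSupport u) (huU : tsupport u ⊆ U)
    (huE : MemLp (diffQuot a u) p (μ.prod μ)) : FracApproximable a p μ U u := by
  intro ε hε
  let φ (n : ℕ) : ContDiffBump (0 : E) :=
    ⟨1 / (n + 1) / 2, 1 / (n + 1), by positivity, half_lt_self (by positivity)⟩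
  have hφ : Tendsto (fun n => (φ n).rOut) atTop (𝓝 0) := tendsto_one_div_add_atTop_nhds_zero_nat
  obtain ⟨δ, hδ, hδU⟩ := huc.isCompact.exists_cthickening_subset_open U.isOpen huU
  obtain ⟨n, hn, hnδ⟩ := ((ENNReal.tendsto_nhds_zero.1
    (tendsto_eLpNorm_diffQuot_convolution_sub hp1 hp hφ hu hloc huE) ε hε).and
    (hφ.eventually_le_const hδ)).exists
  refine ⟨⟨(φ n).normed μ ⋆[ContinuousLinearMap.lsmul ℝ ℝ, μ] u, ?_, ?_, ?_⟩, hn, fun hu0 x => ?_⟩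
  · exact (φ n).hasCompactSupport_normed.contDiff_convolution_left _ (φ n).contDiff_normed hloc
  · exact (φ n).hasCompactSupport_normed.convolution _ huc
  · exact (tsupport_bump_convolution_subset (φ n) u).trans
      ((cthickening_mono hnδ _).trans hδU)
  · exact integral_nonneg fun h => mul_nonneg ((φ n).nonneg_normed h) (hu0 _)

theorem FracApproximable.of_tsupport_subset (hp1 : 1 ≤ p) (hp : p ≠ ∞)
    (hker : MemLp (fun z : E => min 1 ‖z‖ / ‖z‖ ^ a) p μ) (hu : Measurable u)
    (hup : MemLp u p μ) (huU : tsupport u ⊆ U) (huE : MemLp (diffQuot a u) p (μ.prod μ)) :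
    FracApproximable a p μ U u := by
  let v (n : ℕ) : E → ℝ := radialCutoff n * u
  have hv (n : ℕ) : Measurable (v n) := (lipschitzWith_radialCutoff _).continuous.measurable.mul hu
  have hv0 (hu0 : 0 ≤ u) (n : ℕ) : 0 ≤ v n :=
    fun x => mul_nonneg (radialCutoff_mem_Icc _ x).1 (hu0 x)
  have hvp (n : ℕ) : MemLp (v n) p μ := by
    refine hup.mono (hv n).aestronglyMeasurable (.of_forall fun x => ?_)
    change ‖radialCutoff n x * u x‖ ≤ ‖u x‖
    rw [norm_mul, Real.norm_of_nonneg (radialCutoff_mem_Icc _ x).1]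
    exact mul_le_of_le_one_left (norm_nonneg _) (radialCutoff_mem_Icc _ x).2
  refine .of_tendsto hp1 hu huE hv hv0
    (tendsto_eLpNorm_diffQuot_mul_sub (one_pos.trans_le hp1).ne' hp hker
      (fun n => lipschitzWith_radialCutoff n) (fun n => radialCutoff_mem_Icc n)
      tendsto_radialCutoff hu hup huE)
    fun n hvE => .of_hasCompactSupport hp1 hp (hv n) ((hvp n).locallyIntegrable hp1)
      (hasCompactSupport_radialCutoff _).mul_right ?_ hvE
  exact tsupport_mul_subset_right.trans huU

theorem FracApproximable.of_eq_zero_on_ball {R : ℝ} (hp1 : 1 ≤ p) (hp : p ≠ ∞)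
    (hker : MemLp (fun z : E => min 1 ‖z‖ / ‖z‖ ^ a) p μ) (hR : 0 < R)
    (hU : ∀ x, R < ‖x‖ → x ∈ U) (hu : Measurable u) (hup : MemLp u p μ)
    (hu0 : ∀ x ∈ ball 0 R, u x = 0) (huE : MemLp (diffQuot a u) p (μ.prod μ)) :
    FracApproximable a p μ U u := by
  obtain ⟨c, -, hc01, hc⟩ := exists_seq_strictMono_tendsto' (zero_lt_one' ℝ)
  have hc0 (n : ℕ) : 0 < c n := (hc01 n).1
  have hv (n : ℕ) : Measurable fun x => u (c n • x) := hu.comp (by fun_prop)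
  have hvp (n : ℕ) : MemLp (fun x => u (c n • x)) p μ := by
    simpa using memLp_comp_smul_add hup (hc0 n).ne' 0
  refine .of_tendsto hp1 hu huE hv (fun hu0 n x => hu0 (c n • x))
    (tendsto_eLpNorm_diffQuot_comp_smul_sub hp1 hp hc0 hc hu huE)
    fun n hvE => .of_tsupport_subset hp1 hp hker (hv n) (hvp n) ?_ hvE
  have hsupport : tsupport (fun x => u (c n • x)) ⊆ (ball 0 (R / c n))ᶜ := by
    refine closure_minimal (fun x hx hxball => hx (hu0 _ ?_)) isOpen_ball.isClosed_compl
    rw [mem_ball_zero_iff, lt_div_iff₀' (hc0 n)] at hxball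
    rwa [mem_ball_zero_iff, norm_smul, Real.norm_of_nonneg (hc0 n).le]
  refine hsupport.trans fun x hx => hU x ?_
  rw [Set.mem_compl_iff, mem_ball_zero_iff, not_lt] at hx
  exact ((lt_div_iff₀ (hc0 n)).2 (mul_lt_of_lt_one_right hR (hc01 n).2)).trans_le hx

theorem FracApproximable.of_vanishing_at_infinity {R : ℝ} (hp1 : 1 ≤ p) (hp : p ≠ ∞)
    (hker : MemLp (fun z : E => min 1 ‖z‖ / ‖z‖ ^ a) p μ) (hR : 0 < R)
    (hU : ∀ x, R < ‖x‖ → x ∈ U) (hu : Measurable u)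
    (huv : ∀ ε : NNReal, ε ≠ 0 → μ {x | ε ≤ ‖u x‖₊} < ∞)
    (hu0 : ∀ x ∈ ball 0 R, u x = 0) (huE : MemLp (diffQuot a u) p (μ.prod μ)) :
    FracApproximable a p μ U u := by
  have hv (n : ℕ) : Measurable (bandTrunc n ∘ u) :=
    (lipschitzWith_bandTrunc n).continuous.measurable.comp hu
  have hv0 (hupos : 0 ≤ u) (n : ℕ) : 0 ≤ bandTrunc n ∘ u := fun x => bandTrunc_nonneg n (hupos x)
  refine .of_tendsto hp1 hu huE hv hv0
    (tendsto_eLpNorm_diffQuot_comp_sub hp lipschitzWith_bandTrunc tendsto_bandTrunc hu huE)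
    fun n hvE => .of_eq_zero_on_ball hp1 hp hker hR hU (hv n)
      (memLp_bandTrunc_comp hu.aestronglyMeasurable huv p n) (fun x hx => ?_) hvE
  rw [Function.comp_apply, hu0 x hx]
  exact bandTrunc_of_abs_le (by rw [abs_zero]; positivity)

end Approximation

section Representative

theorem exists_measurable_ae_eq_of_ae_eq_zero {X : Type*} [MeasurableSpace X] {μ : Measure X}
    {u : X → ℝ} {t : Set X} (hu : AEMeasurable u μ) (ht : MeasurableSet t)
    (hut : ∀ᵐ x ∂μ, x ∈ t → u x = 0) :
    ∃ w, Measurable w ∧ w =ᵐ[μ] u ∧ (∀ x ∈ t, w x = 0) ∧ ((∀ᵐ x ∂μ, 0 ≤ u x) → 0 ≤ w) := by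
  have hrange : ∀ᵐ x ∂μ, u x ∈ {r | (∀ᵐ x ∂μ, 0 ≤ u x) → 0 ≤ r} :=
    eventually_imp_distrib_left.2 id
  obtain ⟨g, hg, hgrange, hug⟩ := hu.exists_ae_eq_range_subset hrange ⟨0, fun _ => le_rfl⟩
  refine ⟨tᶜ.indicator g, hg.indicator ht.compl, ?_, fun x hx => ?_, fun hu0 x => ?_⟩
  · filter_upwards [hug, hut] with x hx hxt
    by_cases hmem : x ∈ t
    · rw [Set.indicator_of_notMem (Set.notMem_compl_iff.2 hmem), hxt hmem]
    · rw [Set.indicator_of_mem hmem, hx]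
  · exact Set.indicator_of_notMem (Set.notMem_compl_iff.2 hx) g
  · exact Set.indicator_nonneg (fun y _ => hgrange ⟨y, rfl⟩ hu0) x

end Representative

section Gagliardo

variable {N : ℕ} {s : ℝ} {u v : EuclideanSpace ℝ (Fin N) → ℝ}

theorem gagliardoEnergy_congr_ae (h : u =ᵐ[volume] v) :
    gagliardoEnergy s u = gagliardoEnergy s v := by
  refine lintegral_congr_ae ?_
  filter_upwards [h] with y hy
  refine lintegral_congr_ae ?_
  filter_upwards [h] with x hx
  rw [hx, hy]

theorem gagliardoEnergy_eq_eLpNorm_diffQuot (hu : Measurable u) :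
    gagliardoEnergy s u =
      eLpNorm (diffQuot ((N + 2 * s) / 2) u) 2 (volume.prod volume) ^ (2 : ℝ) := by
  have hsq (x y : EuclideanSpace ℝ (Fin N)) :
      ENNReal.ofReal ((u x - u y) ^ 2 / ‖x - y‖ ^ (N + 2 * s)) =
        ‖diffQuot ((N + 2 * s) / 2) u (x, y)‖ₑ ^ (2 : ℝ) := by
    rw [← Real.enorm_eq_ofReal (by positivity), ENNReal.rpow_ofNat, ← enorm_pow, diffQuot, div_pow,
      ← Real.rpow_mul_natCast (norm_nonneg _), Nat.cast_ofNat, div_mul_cancel₀ _ two_ne_zero]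
  have hm : Measurable fun z => ‖diffQuot ((N + 2 * s) / 2) u z‖ₑ ^ (2 : ℝ) :=
    (measurable_diffQuot hu).enorm.pow_const _
  simp only [gagliardoEnergy, hsq]
  rw [← lintegral_prod_symm _ hm.aemeasurable]
  exact (eLpNorm_nnreal_pow_eq_lintegral (p := 2) two_ne_zero).symm

theorem fracNorm_eq_eLpNorm_diffQuot (hu : Measurable u) :
    fracNorm s u = eLpNorm (diffQuot ((N + 2 * s) / 2) u) 2 (volume.prod volume) := by
  rw [fracNorm, gagliardoEnergy_eq_eLpNorm_diffQuot hu, one_div,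
    ENNReal.rpow_rpow_inv two_ne_zero]

theorem memLp_diffQuot_iff_gagliardoEnergy_lt_top (hu : Measurable u) :
    MemLp (diffQuot ((N + 2 * s) / 2) u) 2 (volume.prod volume) ↔ gagliardoEnergy s u < ∞ := by
  rw [gagliardoEnergy_eq_eLpNorm_diffQuot hu, ENNReal.rpow_lt_top_iff_of_pos two_pos]
  exact and_iff_right (measurable_diffQuot hu).aestronglyMeasurable

theorem memLp_gagliardo_kernel (hN : 0 < N) (hs0 : 0 < s) (hs1 : s < 1) :
    MemLp (fun z : EuclideanSpace ℝ (Fin N) => min 1 ‖z‖ / ‖z‖ ^ ((N + 2 * s) / 2)) 2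
      volume := by
  have : Nonempty (Fin N) := ⟨⟨0, hN⟩⟩
  refine memLp_min_one_norm_div_rpow two_ne_zero ENNReal.ofNat_ne_top ?_ ?_ <;>
    rw [finrank_euclideanSpace_fin, ENNReal.toReal_ofNat] <;> linarith

theorem MemFracSobolev.measure_le_nnnorm_lt_top (hu : MemFracSobolev s u) (hs0 : 0 < s)
    (hN : 2 * s < N) {ε : NNReal} (hε : ε ≠ 0) : volume {x | ε ≤ ‖u x‖₊} < ∞ := by
  have hN0 : (0 : ℝ) < N := (mul_pos two_pos hs0).trans hN
  have hexp : 0 < fracCritExp N s :=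
    ENNReal.ofReal_pos.2 (div_pos (mul_pos two_pos hN0) (sub_pos.2 hN))
  exact hu.1.meas_ge_lt_top hexp.ne' ENNReal.ofReal_ne_top hε

theorem memFracSobolev_testFunction {U : TopologicalSpace.Opens (EuclideanSpace ℝ (Fin N))}
    (φ : TestFunction U ℝ (⊤ : ℕ∞)) (hφ : gagliardoEnergy s φ < ∞) : MemFracSobolev s φ :=
  ⟨φ.continuous.memLp_of_hasCompactSupport φ.hasCompactSupport, hφ⟩

theorem FracApproximable.exists_seq {R : ℝ} (hu : Measurable u)
    (huE : gagliardoEnergy s u < ∞)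
    (happrox : FracApproximable ((N + 2 * s) / 2) 2 volume (ballExterior N R) u) :
    ∃ φ : ℕ → TestFunction (ballExterior N R) ℝ (⊤ : ℕ∞),
      (∀ n, gagliardoEnergy s (φ n) < ∞) ∧
      Tendsto (fun n => fracNorm s (fun x => φ n x - u x)) atTop (𝓝 0) ∧
      (0 ≤ u → ∀ n x, 0 ≤ φ n x) := by
  choose φ hφ hφ0 using fun n : ℕ => happrox (n + 1 : ℝ≥0∞)⁻¹ (by simp)
  have hφm (n : ℕ) : Measurable (φ n) := (φ n).continuous.measurable
  refine ⟨φ, fun n => ?_, ?_, fun hu0 n => hφ0 n hu0⟩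
  · rw [← memLp_diffQuot_iff_gagliardoEnergy_lt_top (hφm n)]
    refine memLp_diffQuot_of_sub ⟨(measurable_diffQuot ((hφm n).sub hu)).aestronglyMeasurable,
      (hφ n).trans_lt (by simp)⟩ ((memLp_diffQuot_iff_gagliardoEnergy_lt_top hu).2 huE)
  · have hinv : Tendsto (fun n : ℕ => (n + 1 : ℝ≥0∞)⁻¹) atTop (𝓝 0) := by
      simpa using (tendsto_add_atTop_iff_nat 1).2 ENNReal.tendsto_inv_nat_nhds_zero
    refine tendsto_of_tendsto_of_tendsto_of_le_of_le tendsto_const_nhds hinv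
      (fun _ => zero_le) fun n => ?_
    exact (fracNorm_eq_eLpNorm_diffQuot ((hφm n).fun_sub hu)).trans_le (hφ n)

end Gagliardo

theorem proposition5p4_general {N : ℕ} {s R : ℝ} (hN : 0 < N) (hs0 : 0 < s) (hs1 : s < 1)
    (hR : 0 < R) {u : EuclideanSpace ℝ (Fin N) → ℝ} (hu : AEMeasurable u)
    (huv : ∀ ε : NNReal, ε ≠ 0 → volume {x | ε ≤ ‖u x‖₊} < ∞) (huE : gagliardoEnergy s u < ∞)
    (hu0 : ∀ᵐ x ∂volume, x ∈ ball (0 : EuclideanSpace ℝ (Fin N)) R → u x = 0) :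
    ∃ φ : ℕ → TestFunction (ballExterior N R) ℝ (⊤ : ℕ∞),
      (∀ n, gagliardoEnergy s (φ n) < ∞) ∧
      Tendsto (fun n => fracNorm s (fun x => φ n x - u x)) atTop (𝓝 0) ∧
      ((∀ᵐ x ∂volume, 0 ≤ u x) → ∀ n x, 0 ≤ φ n x) := by
  obtain ⟨w, hw, hwu, hw0, hwpos⟩ :=
    exists_measurable_ae_eq_of_ae_eq_zero hu measurableSet_ball hu0
  have hwv (ε : NNReal) (hε : ε ≠ 0) : volume {x | ε ≤ ‖w x‖₊} < ∞ :=
    (measure_congr (hwu.preimage {t | ε ≤ ‖t‖₊})).trans_lt (huv ε hε)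
  have hwE : gagliardoEnergy s w < ∞ := by rwa [gagliardoEnergy_congr_ae hwu]
  have hU (x : EuclideanSpace ℝ (Fin N)) (hx : R < ‖x‖) : x ∈ ballExterior N R := by
    simpa [ballExterior] using hx
  have happrox : FracApproximable ((N + 2 * s) / 2) 2 volume (ballExterior N R) w :=
    .of_vanishing_at_infinity one_le_two ENNReal.ofNat_ne_top (memLp_gagliardo_kernel hN hs0 hs1)
      hR hU hw hwv hw0 ((memLp_diffQuot_iff_gagliardoEnergy_lt_top hw).2 hwE)
  obtain ⟨φ, hφE, hφ, hφ0⟩ := happrox.exists_seq hw hwE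
  refine ⟨φ, hφE, hφ.congr fun n => ?_, fun hpos => hφ0 (hwpos hpos)⟩
  have hsub : (fun x => φ n x - w x) =ᵐ[volume] fun x => φ n x - u x := .sub .rfl hwu
  rw [fracNorm, fracNorm, gagliardoEnergy_congr_ae hsub]

theorem proposition5p4 (N : ℕ) (s R : ℝ) (hs0 : 0 < s) (hs1 : s < 1) (hN : 2 * s < (N : ℝ))
    (hR : 0 < R) (u : EuclideanSpace ℝ (Fin N) → ℝ) (hu : MemFracSobolev s u)
    (hu0 : ∀ᵐ x ∂volume, x ∈ ball (0 : EuclideanSpace ℝ (Fin N)) R → u x = 0) :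
    ∃ φ : ℕ → TestFunction (ballExterior N R) ℝ (⊤ : ℕ∞),
      (∀ n, MemFracSobolev s (φ n)) ∧
      Tendsto (fun n => fracNorm s (fun x => φ n x - u x)) atTop (𝓝 0) ∧
      ((∀ᵐ x ∂volume, 0 ≤ u x) → ∀ n x, 0 ≤ φ n x) := by
  have hN0 : 0 < N := Nat.cast_pos.1 ((mul_pos two_pos hs0).trans hN)
  obtain ⟨φ, hφE, hφ⟩ := proposition5p4_general hN0 hs0 hs1 hR hu.1.1.aemeasurable
    (fun _ => hu.measure_le_nnnorm_lt_top hs0 hN) hu.2 hu0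
  exact ⟨φ, fun n => memFracSobolev_testFunction (φ n) (hφE n), hφ⟩
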